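/- Call a random $n\times n$ orthogonal matrix $U$ Haar-distributed if its law is the Haar probability measure on the orthogonal group $\mathbb{O}(n)$. For integers $p\le n$ with $p\geq 1$, let $U_{p\times n}$ be the matrix of the first $p$ rows of $U$ and define $Q\in\mathbb{R}^{n\times p}$ by $Q^{\top}=\sqrt{n/p}\,U_{p\times n}$. For $\alpha,\beta\in(0,1/2)$, a random matrix $Q\in\mathbb{R}^{n\times p}$ is called $(1-\beta)$-probabilistically $\alpha$-well aligned if $\mathbb{P}\left(\|Q^{\top}v\|\ge \alpha\|v\|\right)\ge 1-\beta$ for every $v\in\mathbb{R}^n$, where $\|\cdot\|$ is the Euclidean norm. Theorem. There is an absolute constant $\eta>0$ such that the following holds for all $\varepsilon_Q,\beta_Q\in(0,1)$. (1) For all integers $1\le p\le n$ with $p\ge \frac{4}{\eta}\,\varepsilon_Q^{-2}\log\left(\frac{2}{\beta_Q}\right)$ and every Haar-distributed random matrix $U\in\mathbb{O}(n)$, the matrix $Q$ defined above satisfies $$\mathbb{P}\left((1-\varepsilon_Q)\|x\|\le\|Q^{\top}x\|\le(1+\varepsilon_Q)\|x\|\right)\ge 1-\beta_Q\qquad\text{for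 all } x\in\mathbb{R}^n.$$ In particular, if $\beta_Q<1/2$, then $Q$ is $(1-\beta_Q)$-probabilistically $\alpha_Q$-well aligned for every $\alpha_Q\in(0,1/2)$ with $\alpha_Q\le 1-\varepsilon_Q$. (2) In particular, $p$ can be chosen independently of $n$: there is an integer $p_0\ge 1$, depending only on $\varepsilon_Q$ and $\beta_Q$, such that the conclusions of (1) hold for all integers $p_0\le p\le n$ and every Haar-distributed random matrix $U\in\mathbb{O}(n)$. -/

import Mathlib

open MeasureTheory

universe u

/-- The orthogonal group `O(n)` carries the Borel σ-algebra of its topology as a subspace of the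
real `n × n` matrices. -/
noncomputable instance orthogonalGroupMeasurableSpace (n : ℕ) :
    MeasurableSpace (Matrix.orthogonalGroup (Fin n) ℝ) := borel _

instance orthogonalGroupBorelSpace (n : ℕ) :
    BorelSpace (Matrix.orthogonalGroup (Fin n) ℝ) := ⟨rfl⟩

/-- A random orthogonal matrix is Haar-distributed if its law is a Haar measure on `O(n)`. When `P`
is a probability measure, the law is therefore the unique Haar probability measure. -/
def IsHaarDistributed {Ω : Type*} [MeasurableSpace Ω] {n : ℕ}
    (U : Ω → Matrix.orthogonalGroup (Fin n) ℝ) (P : Measure Ω) : Prop :=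
  AEMeasurable U P ∧ (P.map U).IsHaarMeasure

/-- The `p × n` matrix of the first `p` rows of an `n × n` matrix. -/
def firstRows {p n : ℕ} (hpn : p ≤ n) (U : Matrix (Fin n) (Fin n) ℝ) :
    Matrix (Fin p) (Fin n) ℝ :=
  U.submatrix (Fin.castLE hpn) id

/-- The `n × p` matrix `Q` with `Qᵀ = √(n / p) • (first p rows of U)`. -/
noncomputable def haarSketch {p n : ℕ} (hpn : p ≤ n) (U : Matrix.orthogonalGroup (Fin n) ℝ) :
    Matrix (Fin n) (Fin p) ℝ :=
  (Real.sqrt ((n : ℝ) / (p : ℝ)) • firstRows hpn (U : Matrix (Fin n) (Fin n) ℝ)).transpose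

/-- The Euclidean norm `‖Qᵀ x‖`. -/
noncomputable def normTransposeMulVec {n p : ℕ} (Q : Matrix (Fin n) (Fin p) ℝ)
    (x : EuclideanSpace ℝ (Fin n)) : ℝ :=
  ‖(WithLp.toLp 2 (Q.transpose.mulVec x.ofLp) : EuclideanSpace ℝ (Fin p))‖

/-- For every fixed `x`, with probability at least `1 - β`, the map `x ↦ Qᵀ x` preserves the norm of
`x` up to a relative error `ε`. -/
def IsJLTransform {Ω : Type*} [MeasurableSpace Ω] {n p : ℕ} (ε β : ℝ)
    (Q : Ω → Matrix (Fin n) (Fin p) ℝ) (P : Measure Ω) : Prop :=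
  ∀ x : EuclideanSpace ℝ (Fin n),
    1 - β ≤ P.real {ω | (1 - ε) * ‖x‖ ≤ normTransposeMulVec (Q ω) x ∧
      normTransposeMulVec (Q ω) x ≤ (1 + ε) * ‖x‖}

/-- For `α, β ∈ (0, 1/2)`, the random matrix `Q` is `(1 - β)`-probabilistically `α`-well aligned if
for every fixed `v`, `P (‖Qᵀ v‖ ≥ α ‖v‖) ≥ 1 - β`. -/
def IsWellAligned {Ω : Type*} [MeasurableSpace Ω] {n p : ℕ} (α β : ℝ)
    (Q : Ω → Matrix (Fin n) (Fin p) ℝ) (P : Measure Ω) : Prop :=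
  α ∈ Set.Ioo (0 : ℝ) (1 / 2) ∧ β ∈ Set.Ioo (0 : ℝ) (1 / 2) ∧
  (∀ i j, AEMeasurable (fun ω => Q ω i j) P) ∧
  ∀ v : EuclideanSpace ℝ (Fin n),
    1 - β ≤ P.real {ω | α * ‖v‖ ≤ normTransposeMulVec (Q ω) v}

/-! For a fixed nonzero `x`, a Haar-distributed `U` sends `x` to a uniformly random direction, and
so does a standard Gaussian vector `g`. Events invariant under positive scaling therefore have the
same probability for `U x` and for `g` (`haar_apply_eq_stdGaussian`). Comparing the norm of the
sketch with `(1 + δ) ‖x‖` is such an event: it compares the sum of the first `p` squares with a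
multiple of the sum of all `n`. For `g` this is the sign of a diagonal quadratic form, and an
exponential Markov bound gives at most `exp (-p δ² / 2)`, with no dependence on `n`. A union bound
over `δ = ε` and `δ = -ε` finishes. -/

/-! ### Exponential bounds for Gaussian quadratic forms -/

open ProbabilityTheory in
lemma integral_exp_mul_sq_gaussianReal (d : ℝ) :
    ∫ x, Real.exp (d * x ^ 2) ∂(gaussianReal 0 1) = √(1 / (1 - 2 * d)) := by
  rw [integral_gaussianReal_eq_integral_smul one_ne_zero]
  have h : ∀ x : ℝ, gaussianPDFReal 0 1 x • Real.exp (d * x ^ 2) =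
      (√(2 * Real.pi))⁻¹ * Real.exp (-(1 / 2 - d) * x ^ 2) := by
    intro x
    rw [gaussianPDFReal_def, smul_eq_mul]
    simp only [NNReal.coe_one, mul_one, mul_assoc, ← Real.exp_add]
    congr 2
    ring
  simp_rw [h]
  rw [integral_const_mul, integral_gaussian, ← Real.sqrt_inv, ← Real.sqrt_mul (by positivity)]
  congr 1
  rw [show (1 : ℝ) / 2 - d = (1 - 2 * d) / 2 by ring, div_div_eq_mul_div, mul_comm Real.pi 2,
    ← mul_div_assoc, inv_mul_cancel₀ (by positivity)]

open ProbabilityTheory in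
lemma measureReal_pi_gaussianReal_sum_mul_sq_nonneg_le {ι : Type*} [Fintype ι] (d : ι → ℝ)
    (hd : ∀ i, 2 * d i < 1) :
    (Measure.pi fun _ : ι => gaussianReal 0 1).real {x | 0 ≤ ∑ i, d i * x i ^ 2} ≤
      ∏ i, √(1 / (1 - 2 * d i)) := by
  have hprod : ∀ x : ι → ℝ, Real.exp (∑ i, d i * x i ^ 2) = ∏ i, Real.exp (d i * x i ^ 2) :=
    fun x => Real.exp_sum _ _
  have hint : Integrable (fun x : ι → ℝ => Real.exp (∑ i, d i * x i ^ 2))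
      (Measure.pi fun _ : ι => gaussianReal 0 1) := by
    simp_rw [hprod]
    refine Integrable.fintype_prod (f := fun i (x : ℝ) => Real.exp (d i * x ^ 2)) fun i => ?_
    -- The closed form holds for every `d`, both sides being `0` when `2 * d ≥ 1`; a nonzero value
    -- thus certifies integrability.
    refine Integrable.of_integral_ne_zero ?_
    rw [integral_exp_mul_sq_gaussianReal]
    have := hd i
    exact (Real.sqrt_pos.2 (one_div_pos.2 (by linarith))).ne'
  have h := mul_meas_ge_le_integral_of_nonneg
    (Filter.Eventually.of_forall fun x => (Real.exp_pos _).le) hint 1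
  simp_rw [hprod] at h
  rw [integral_fintype_prod_eq_prod (f := fun i (x : ℝ) => Real.exp (d i * x ^ 2))] at h
  simp_rw [integral_exp_mul_sq_gaussianReal, ← hprod, Real.one_le_exp_iff, one_mul] at h
  exact h

-- The outer factor `δ` treats both tails at once: its sign selects the upper or the lower
-- deviation.
open ProbabilityTheory in
lemma measureReal_pi_gaussianReal_partial_norm_deviation_le {n p : ℕ} (hp : 0 < p) (hpn : p ≤ n)
    {δ : ℝ} (hδ : -1 < δ) :
    (Measure.pi fun _ : Fin n => gaussianReal 0 1).real
      {x | 0 < δ * (∑ j : Fin p, x (Fin.castLE hpn j) ^ 2 -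
        (1 + δ) ^ 2 * (p / n) * ∑ i, x i ^ 2)} ≤ Real.exp (-(p * δ ^ 2 / 2)) := by
  have hn : 0 < n := hp.trans_le hpn
  have hp' : (0 : ℝ) < p := by exact_mod_cast hp
  have hn' : (0 : ℝ) < n := by exact_mod_cast hn
  set a : ℝ := (1 + δ) ^ 2 with ha
  set q : ℝ := p / n with hq
  have ha0 : 0 < a := by have : 0 < 1 + δ := by linarith
                         positivity
  have hq0 : 0 < q := by positivity
  have hhead : ∀ x : Fin n → ℝ, ∑ j : Fin p, x (Fin.castLE hpn j) ^ 2 =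
      ∑ i : Fin n, if (i : ℕ) < p then x i ^ 2 else 0 := by
    intro x
    rw [← Finset.sum_filter]
    refine Finset.sum_bij (fun j _ => Fin.castLE hpn j) (by simp) (by simp) ?_ (by simp)
    intro i hi
    exact ⟨⟨i, by simpa using hi⟩, by simp, rfl⟩
  have hle : ∀ x : Fin n → ℝ, ∑ j : Fin p, x (Fin.castLE hpn j) ^ 2 ≤ ∑ i, x i ^ 2 := by
    intro x
    rw [hhead]
    refine Finset.sum_le_sum fun i _ => ?_
    split_ifs <;> [exact le_rfl; positivity]
  have hempty : (∀ x : Fin n → ℝ, δ * (∑ j : Fin p, x (Fin.castLE hpn j) ^ 2 -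
      a * q * ∑ i, x i ^ 2) ≤ 0) → (Measure.pi fun _ : Fin n => gaussianReal 0 1).real
      {x | 0 < δ * (∑ j : Fin p, x (Fin.castLE hpn j) ^ 2 - a * q * ∑ i, x i ^ 2)} ≤
        Real.exp (-(p * δ ^ 2 / 2)) := by
    intro h
    rw [show {x : Fin n → ℝ | 0 < δ * (∑ j : Fin p, x (Fin.castLE hpn j) ^ 2 -
      a * q * ∑ i, x i ^ 2)} = ∅ from Set.eq_empty_of_forall_notMem fun x hx => (h x).not_gt hx]
    simpa using (Real.exp_pos _).le
  have hsq : ∀ x : Fin n → ℝ, 0 ≤ ∑ i, x i ^ 2 := fun x => Finset.sum_nonneg fun i _ => sq_nonneg _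
  have hq1 : q ≤ 1 := (div_le_one hn').2 (by exact_mod_cast hpn)
  -- The tilt below divides by `1 - a * q` and `1 - q`. If `a * q ≥ 1` or `p = n`, the event is
  -- empty.
  rcases le_or_gt 1 (a * q) with haq | haq
  · refine hempty fun x => mul_nonpos_of_nonneg_of_nonpos ?_ ?_
    · by_contra! hneg
      have : a < 1 := by nlinarith
      nlinarith
    · nlinarith [hle x, hsq x]
  rcases hpn.eq_or_lt with rfl | hlt
  · have hq' : q = 1 := div_self hn'.ne'
    have hδ0 : δ ≤ 0 := by
      by_contra! hpos
      rw [hq', mul_one] at haq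
      nlinarith
    refine hempty fun x => mul_nonpos_of_nonpos_of_nonneg hδ0 ?_
    have : ∑ j : Fin p, x (Fin.castLE hpn j) ^ 2 = ∑ i, x i ^ 2 := rfl
    rw [this]
    nlinarith [hsq x]
  have hlt' : (p : ℝ) < n := by exact_mod_cast hlt
  have hq1' : q < 1 := (div_lt_one hn').2 hlt'
  have h1aq : 0 < 1 - a * q := by linarith
  -- the optimal exponential tilt
  set l : ℝ := (1 - 1 / a) / (1 - a * q) / 2 with hl
  set d : Fin n → ℝ := fun i => l * ((if (i : ℕ) < p then 1 else 0) - a * q) with hd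
  -- With this `l`, each of the first `p` coordinates contributes `√a = 1 + δ` to the product, and
  -- each other one `√((1 - a q) / (1 - q))`.
  have hd1 : 1 - 2 * (l * (1 - a * q)) = 1 / a := by
    rw [hl]; field_simp; ring
  have hd2 : 1 - 2 * (l * (0 - a * q)) = (1 - q) / (1 - a * q) := by
    rw [hl]; field_simp; ring
  have hd' : ∀ i, 1 / (1 - 2 * d i) =
      if (i : ℕ) < p then a else (1 - a * q) / (1 - q) := by
    intro i
    simp only [hd]
    split_ifs
    · rw [hd1, one_div_one_div]
    · rw [hd2, one_div_div]
  have hpos : ∀ i, 0 < 1 / (1 - 2 * d i) := by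
    intro i
    rw [hd' i]
    split_ifs
    · exact ha0
    · exact div_pos h1aq (by linarith)
  have hsum : ∀ x : Fin n → ℝ, ∑ i, d i * x i ^ 2 =
      l * (∑ j : Fin p, x (Fin.castLE hpn j) ^ 2 - a * q * ∑ i, x i ^ 2) := by
    intro x
    rw [hhead, Finset.mul_sum, ← Finset.sum_sub_distrib, Finset.mul_sum]
    refine Finset.sum_congr rfl fun i _ => ?_
    simp only [hd]
    split_ifs <;> ring
  have hbound := measureReal_pi_gaussianReal_sum_mul_sq_nonneg_le d fun i => by
    have := one_div_pos.1 (hpos i)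
    linarith
  refine (measureReal_mono ?_).trans (hbound.trans ?_)
  · intro x hx
    simp only [Set.mem_ofPred_eq] at hx ⊢
    rw [hsum]
    set Y := ∑ j : Fin p, x (Fin.castLE hpn j) ^ 2 - a * q * ∑ i, x i ^ 2
    -- `l` is a positive multiple of `δ`, so the event makes the tilted form nonnegative.
    have hlδ : l = δ * ((2 + δ) / a / (1 - a * q) / 2) := by
      rw [hl]; field_simp; rw [ha]; ring
    rw [hlδ, mul_right_comm]
    have : 0 < 2 + δ := by linarith
    positivity
  -- Applying `1 + t ≤ exp t` to both kinds of factor leaves the exponent `p δ + p (1 - (1 + δ)²) /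
  -- 2 = -p δ² / 2`.
  · have hw : (1 - a * q) / (1 - q) - 1 = (1 - a) * p / (n - p) := by
      have h1 : (n : ℝ) - p ≠ 0 := by linarith
      have h2 : 1 - q ≠ 0 := by linarith
      rw [div_sub_one h2, div_eq_div_iff h2 h1, hq]
      field_simp
      ring
    have hsqrt_a : √a ≤ Real.exp δ := by
      rw [ha, Real.sqrt_sq (by linarith)]
      linarith [Real.add_one_le_exp δ]
    have hsqrt_w : √((1 - a * q) / (1 - q)) ≤ Real.exp ((1 - a) * p / (n - p) / 2) := by
      refine Real.sqrt_le_iff.2 ⟨(Real.exp_pos _).le, ?_⟩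
      rw [← Real.exp_nat_mul, ← hw]
      push_cast
      rw [mul_div_cancel₀ _ two_ne_zero]
      linarith [Real.add_one_le_exp ((1 - a * q) / (1 - q) - 1)]
    have hcard : (Finset.univ.filter fun i : Fin n => (i : ℕ) < p).card = p := by
      rw [Fin.card_filter_val_lt, min_eq_right hpn]
    have hcard' : (Finset.univ.filter fun i : Fin n => ¬ (i : ℕ) < p).card = n - p := by
      have := Finset.card_filter_add_card_filter_not (s := (Finset.univ : Finset (Fin n)))
        (fun i : Fin n => (i : ℕ) < p)
      rw [hcard, Finset.card_univ, Fintype.card_fin] at this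
      omega
    simp_rw [hd', apply_ite Real.sqrt]
    rw [Finset.prod_ite, Finset.prod_const, Finset.prod_const, hcard, hcard']
    calc √a ^ p * √((1 - a * q) / (1 - q)) ^ (n - p)
        ≤ Real.exp δ ^ p * Real.exp ((1 - a) * p / (n - p) / 2) ^ (n - p) := by gcongr
      _ = Real.exp (-(p * δ ^ 2 / 2)) := by
        rw [← Real.exp_nat_mul, ← Real.exp_nat_mul, ← Real.exp_add, Nat.cast_sub hpn]
        congr 1
        have h1 : (n : ℝ) - p ≠ 0 := by linarith
        field_simp
        rw [ha]
        ring

/-! ### Haar measure on the orthogonal group and its action -/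

instance orthogonalGroupLocallyCompactSpace (n : ℕ) :
    LocallyCompactSpace (Matrix.orthogonalGroup (Fin n) ℝ) := by
  have h1 : LocallyCompactSpace (Matrix (Fin n) (Fin n) ℝ) :=
    inferInstanceAs (LocallyCompactSpace (Fin n → Fin n → ℝ))
  exact (isClosed_unitary (R := Matrix (Fin n) (Fin n) ℝ)).locallyCompactSpace

instance orthogonalGroupSecondCountableTopology (n : ℕ) :
    SecondCountableTopology (Matrix.orthogonalGroup (Fin n) ℝ) := by
  have h1 : SecondCountableTopology (Matrix (Fin n) (Fin n) ℝ) :=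
    inferInstanceAs (SecondCountableTopology (Fin n → Fin n → ℝ))
  exact TopologicalSpace.Subtype.secondCountableTopology _

/-- The orthogonal group as the group of linear isometries of Euclidean space. -/
noncomputable def orthogonalGroupEquivLinearIsometryEquiv (n : ℕ) :
    Matrix.orthogonalGroup (Fin n) ℝ ≃*
      (EuclideanSpace ℝ (Fin n) ≃ₗᵢ[ℝ] EuclideanSpace ℝ (Fin n)) :=
  (Unitary.mapEquiv
    { (Matrix.toEuclideanCLM (n := Fin n) (𝕜 := ℝ) : _ ≃* _) with
      map_star' := map_star (Matrix.toEuclideanCLM (n := Fin n) (𝕜 := ℝ)) }).toMulEquiv.trans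
    Unitary.linearIsometryEquiv

lemma orthogonalGroupEquivLinearIsometryEquiv_apply {n : ℕ}
    (U : Matrix.orthogonalGroup (Fin n) ℝ) (x : EuclideanSpace ℝ (Fin n)) :
    orthogonalGroupEquivLinearIsometryEquiv n U x =
      WithLp.toLp 2 (Matrix.mulVec (U : Matrix (Fin n) (Fin n) ℝ) x.ofLp) := rfl

/-- A right translate of a left Haar probability measure is another one, and such a measure is
unique. -/
lemma haar_isMulRightInvariant {n : ℕ} (μ : Measure (Matrix.orthogonalGroup (Fin n) ℝ))
    [IsProbabilityMeasure μ] [μ.IsHaarMeasure] (V : Matrix.orthogonalGroup (Fin n) ℝ) :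
    μ.map (· * V) = μ := by
  have : IsProbabilityMeasure (μ.map (· * V)) :=
    Measure.isProbabilityMeasure_map (measurable_mul_const V).aemeasurable
  exact Measure.isHaarMeasure_eq_of_isProbabilityMeasure _ _

lemma continuous_orthogonalGroup_smul (n : ℕ) :
    Continuous fun z : Matrix.orthogonalGroup (Fin n) ℝ × EuclideanSpace ℝ (Fin n) =>
      orthogonalGroupEquivLinearIsometryEquiv n z.1 z.2 := by
  simp_rw [orthogonalGroupEquivLinearIsometryEquiv_apply]
  refine (PiLp.continuous_toLp 2 _).comp ?_
  exact Continuous.matrix_mulVec (continuous_subtype_val.comp continuous_fst)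
    ((PiLp.continuous_ofLp 2 _).comp continuous_snd)

-- Integrate the indicator of `U y ∈ B` over both `U` and a Gaussian `y`. Over `y` first, rotation
-- invariance gives the Gaussian mass of `B`; over `U` first, the result is the same for all `y ≠
-- 0`.
open ProbabilityTheory in
lemma haar_apply_eq_stdGaussian {n : ℕ} (hn : 0 < n)
    (μ : Measure (Matrix.orthogonalGroup (Fin n) ℝ))
    [IsProbabilityMeasure μ] [μ.IsHaarMeasure] {B : Set (EuclideanSpace ℝ (Fin n))}
    (hB : MeasurableSet B) (hcone : ∀ c : ℝ, 0 < c → ∀ y, c • y ∈ B ↔ y ∈ B)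
    {x : EuclideanSpace ℝ (Fin n)} (hx : x ≠ 0) :
    μ ((fun U => orthogonalGroupEquivLinearIsometryEquiv n U x) ⁻¹' B) =
      stdGaussian (EuclideanSpace ℝ (Fin n)) B := by
  set φ := orthogonalGroupEquivLinearIsometryEquiv n
  have hcont := continuous_orthogonalGroup_smul n
  have hφx : ∀ y, Measurable fun U => φ U y := fun y =>
    (hcont.comp (Continuous.prodMk_left y)).measurable
  have hconst : ∀ y : EuclideanSpace ℝ (Fin n), y ≠ 0 → μ ((fun U => φ U y) ⁻¹' B) = μ ((fun U => φ U x) ⁻¹' B) := by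
    intro y hy
    have hx0 := norm_pos_iff.2 hx
    have hy0 := norm_pos_iff.2 hy
    -- A hyperplane reflection carries `y` to the multiple of `x` of equal norm; right invariance
    -- absorbs it and the cone property removes the scalar.
    obtain ⟨V, hV⟩ := φ.surjective
      (ℝ ∙ (y - (‖y‖ / ‖x‖) • x))ᗮ.reflection
    have hVy : φ V y = (‖y‖ / ‖x‖) • x := by
      rw [hV]
      refine Submodule.reflection_sub ?_
      rw [norm_smul, norm_div, norm_norm, norm_norm, div_mul_cancel₀ _ hx0.ne']
    calc μ ((fun U => φ U y) ⁻¹' B) = μ.map (· * V⁻¹) ((fun U => φ U ((‖y‖ / ‖x‖) • x)) ⁻¹' B) := by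
          rw [Measure.map_apply (measurable_mul_const _) (hφx _ hB)]
          congr 1
          ext U
          simp [← hVy, map_mul]
      _ = μ ((fun U => φ U x) ⁻¹' B) := by
          rw [haar_isMulRightInvariant]
          congr 1
          ext U
          simp only [Set.mem_preimage, map_smul]
          exact hcone _ (by positivity) _
  have hzero : ∀ᵐ y ∂(stdGaussian (EuclideanSpace ℝ (Fin n))), y ≠ 0 := by
    have : Nonempty (Fin n) := ⟨⟨0, hn⟩⟩
    have : NullSingletonClass (gaussianReal 0 1) := nullSingletonClass_gaussianReal one_ne_zero
    rw [← map_pi_eq_stdGaussian, ae_iff, Measure.map_apply (by fun_prop) (by simp)]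
    have h0 : (WithLp.toLp 2 ⁻¹' {a : EuclideanSpace ℝ (Fin n) | ¬ a ≠ 0}) = {0} := by
      ext z; simp
    rw [h0]
    have := Measure.pi_nullSingletonClass (μ := fun _ : Fin n => gaussianReal 0 1) ⟨0, hn⟩
    exact measure_singleton _
  have hswap := lintegral_lintegral_swap (μ := stdGaussian (EuclideanSpace ℝ (Fin n))) (ν := μ)
    (f := fun y U => B.indicator 1 (φ U y))
    ((measurable_one.indicator hB).comp
      (hcont.measurable.comp measurable_swap)).aemeasurable
  have hl : ∀ y, ∫⁻ U, B.indicator 1 (φ U y) ∂μ = μ ((fun U => φ U y) ⁻¹' B) := fun y => by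
    rw [← lintegral_indicator_one (hφx y hB)]
    rfl
  have hr : ∀ U, ∫⁻ y, B.indicator 1 (φ U y) ∂(stdGaussian (EuclideanSpace ℝ (Fin n))) =
      stdGaussian (EuclideanSpace ℝ (Fin n)) B := fun U => by
    rw [← lintegral_map (f := B.indicator 1) (measurable_one.indicator hB)
      (φ U).continuous.measurable, stdGaussian_map, lintegral_indicator_one hB]
  simp_rw [hl, hr] at hswap
  rw [lintegral_congr_ae (hzero.mono fun y hy => hconst y hy)] at hswap
  simpa using hswap

/-! ### Norm preservation by the sketch -/

lemma normTransposeMulVec_haarSketch_sq {n p : ℕ} (hpn : p ≤ n)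
    (U : Matrix.orthogonalGroup (Fin n) ℝ) (x : EuclideanSpace ℝ (Fin n)) :
    normTransposeMulVec (haarSketch hpn U) x ^ 2 = n / p *
      ∑ j : Fin p, orthogonalGroupEquivLinearIsometryEquiv n U x (Fin.castLE hpn j) ^ 2 := by
  rw [normTransposeMulVec, EuclideanSpace.real_norm_sq_eq, Finset.mul_sum]
  refine Finset.sum_congr rfl fun j _ => ?_
  rw [haarSketch, Matrix.transpose_transpose, Matrix.smul_mulVec]
  change (√(n / p) * Matrix.mulVec (U : Matrix (Fin n) (Fin n) ℝ) x.ofLp (Fin.castLE hpn j)) ^ 2 = _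
  rw [mul_pow, Real.sq_sqrt (by positivity)]
  rfl

open ProbabilityTheory in
lemma measureReal_haarSketch_deviation_le {Ω : Type*} [MeasurableSpace Ω] {P : Measure Ω}
    [IsProbabilityMeasure P] {n p : ℕ} (hp : 0 < p) (hpn : p ≤ n)
    {U : Ω → Matrix.orthogonalGroup (Fin n) ℝ} (hU : IsHaarDistributed U P)
    {x : EuclideanSpace ℝ (Fin n)} (hx : x ≠ 0) {δ : ℝ} (hδ : -1 < δ) :
    P.real {ω | 0 < δ * (normTransposeMulVec (haarSketch hpn (U ω)) x ^ 2 -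
      (1 + δ) ^ 2 * ‖x‖ ^ 2)} ≤ Real.exp (-(p * δ ^ 2 / 2)) := by
  have hn : 0 < n := hp.trans_le hpn
  have hp' : (0 : ℝ) < p := by exact_mod_cast hp
  have hn' : (0 : ℝ) < n := by exact_mod_cast hn
  obtain ⟨hmeas, hhaar⟩ := hU
  have : IsProbabilityMeasure (P.map U) := Measure.isProbabilityMeasure_map hmeas
  set B : Set (EuclideanSpace ℝ (Fin n)) := {y | 0 < δ * (∑ j : Fin p, y (Fin.castLE hpn j) ^ 2 -
        (1 + δ) ^ 2 * (p / n) * ∑ i, y i ^ 2)} with hB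
  have hBmeas : MeasurableSet B := measurableSet_lt (by fun_prop) (by fun_prop)
  have hcone : ∀ c : ℝ, 0 < c → ∀ y, c • y ∈ B ↔ y ∈ B := by
    intro c hc y
    have hscale : δ * (∑ j : Fin p, (c • y) (Fin.castLE hpn j) ^ 2 -
        (1 + δ) ^ 2 * (p / n) * ∑ i, (c • y) i ^ 2) = c ^ 2 *
        (δ * (∑ j : Fin p, y (Fin.castLE hpn j) ^ 2 -
        (1 + δ) ^ 2 * (p / n) * ∑ i, y i ^ 2)) := by
      simp only [PiLp.smul_apply, smul_eq_mul, mul_pow, ← Finset.mul_sum]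
      ring
    simp only [hB, Set.mem_ofPred_eq]
    rw [hscale, mul_pos_iff_of_pos_left (by positivity)]
  have hset : {ω | 0 < δ * (normTransposeMulVec (haarSketch hpn (U ω)) x ^ 2 -
      (1 + δ) ^ 2 * ‖x‖ ^ 2)} =
      U ⁻¹' ((fun V => orthogonalGroupEquivLinearIsometryEquiv n V x) ⁻¹' B) := by
    ext ω
    simp only [hB, Set.mem_preimage, Set.mem_ofPred_eq]
    rw [normTransposeMulVec_haarSketch_sq,
      ← (orthogonalGroupEquivLinearIsometryEquiv n (U ω)).norm_map x,
      ← EuclideanSpace.real_norm_sq_eq]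
    set S := ∑ j : Fin p,
      orthogonalGroupEquivLinearIsometryEquiv n (U ω) x (Fin.castLE hpn j) ^ 2
    set N := ‖orthogonalGroupEquivLinearIsometryEquiv n (U ω) x‖ ^ 2
    rw [show δ * (n / p * S - (1 + δ) ^ 2 * N) =
      n / p * (δ * (S - (1 + δ) ^ 2 * (p / n) * N)) by field_simp,
      mul_pos_iff_of_pos_left (by positivity)]
  have hcont : Measurable fun V => orthogonalGroupEquivLinearIsometryEquiv n V x :=
    ((continuous_orthogonalGroup_smul n).comp (Continuous.prodMk_left x)).measurable
  rw [hset, measureReal_def, ← Measure.map_apply_of_aemeasurable hmeas (hcont hBmeas),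
    haar_apply_eq_stdGaussian hn _ hBmeas hcone hx, ← map_pi_eq_stdGaussian,
    Measure.map_apply (by fun_prop) hBmeas]
  exact measureReal_pi_gaussianReal_partial_norm_deviation_le hp hpn hδ

lemma isJLTransform_haarSketch {Ω : Type*} [MeasurableSpace Ω] {P : Measure Ω}
    [IsProbabilityMeasure P] {n p : ℕ} (hpn : p ≤ n)
    {U : Ω → Matrix.orthogonalGroup (Fin n) ℝ} (hU : IsHaarDistributed U P)
    {ε β : ℝ} (hε : ε ∈ Set.Ioo (0 : ℝ) 1) (hβ : β ∈ Set.Ioo (0 : ℝ) 1)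
    (hp : 2 * ε⁻¹ ^ 2 * Real.log (2 / β) ≤ p) :
    IsJLTransform ε β (fun ω => haarSketch hpn (U ω)) P := by
  obtain ⟨hε0, hε1⟩ := hε
  obtain ⟨hβ0, hβ1⟩ := hβ
  have hlog : 0 < Real.log (2 / β) := Real.log_pos ((one_lt_div hβ0).2 (by linarith))
  have hp' : (0 : ℝ) < p := lt_of_lt_of_le (by positivity) hp
  have hp0 : 0 < p := by exact_mod_cast hp'
  have htail : Real.exp (-(p * ε ^ 2 / 2)) ≤ β / 2 := by
    rw [← Real.exp_log (half_pos hβ0), Real.exp_le_exp, ← inv_div 2 β, Real.log_inv]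
    have : Real.log (2 / β) = 2 * ε⁻¹ ^ 2 * Real.log (2 / β) * ε ^ 2 / 2 := by field_simp
    rw [this]
    gcongr
  intro x
  rcases eq_or_ne x 0 with rfl | hx
  · have : ∀ ω, normTransposeMulVec (haarSketch hpn (U ω)) 0 = 0 := fun ω => by
      simp [normTransposeMulVec]
    simp only [this, norm_zero, mul_zero, le_refl, and_self]
    rw [Set.ofPred_true, probReal_univ]
    linarith
  set good := {ω | (1 - ε) * ‖x‖ ≤ normTransposeMulVec (haarSketch hpn (U ω)) x ∧
      normTransposeMulVec (haarSketch hpn (U ω)) x ≤ (1 + ε) * ‖x‖} with hgood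
  set bad : ℝ → Set Ω := fun δ => {ω | 0 < δ *
    (normTransposeMulVec (haarSketch hpn (U ω)) x ^ 2 - (1 + δ) ^ 2 * ‖x‖ ^ 2)} with hbad
  have hbad1 : P.real (bad ε) ≤ β / 2 :=
    (measureReal_haarSketch_deviation_le hp0 hpn hU hx (by linarith)).trans htail
  have hbad2 : P.real (bad (-ε)) ≤ β / 2 := by
    refine (measureReal_haarSketch_deviation_le hp0 hpn hU hx (by linarith)).trans ?_
    rwa [neg_sq]
  -- Covering the whole space bounds `good` from below by subadditivity alone, without measurability
  -- of these events.
  have hcover : Set.univ ⊆ good ∪ (bad (-ε) ∪ bad ε) := by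
    intro ω _
    have hN : 0 ≤ normTransposeMulVec (haarSketch hpn (U ω)) x := norm_nonneg _
    rcases lt_or_ge (normTransposeMulVec (haarSketch hpn (U ω)) x) ((1 - ε) * ‖x‖) with h1 | h1
    · refine Or.inr (Or.inl ?_)
      change 0 < -ε * (_ - (1 + -ε) ^ 2 * _)
      refine mul_pos_of_neg_of_neg (by linarith) ?_
      have := pow_lt_pow_left₀ h1 hN two_ne_zero
      rw [mul_pow] at this
      rw [← sub_eq_add_neg]
      linarith
    rcases lt_or_ge ((1 + ε) * ‖x‖) (normTransposeMulVec (haarSketch hpn (U ω)) x) with h2 | h2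
    · refine Or.inr (Or.inr ?_)
      change 0 < ε * (_ - (1 + ε) ^ 2 * _)
      refine mul_pos hε0 ?_
      have := pow_lt_pow_left₀ h2 (by positivity) two_ne_zero
      rw [mul_pow] at this
      linarith
    · exact Or.inl ⟨h1, h2⟩
  have h1 : (1 : ℝ) ≤ P.real good + (P.real (bad (-ε)) + P.real (bad ε)) := by
    rw [← probReal_univ (μ := P)]
    refine (measureReal_mono hcover).trans ((measureReal_union_le _ _).trans ?_)
    gcongr
    exact measureReal_union_le _ _
  change 1 - β ≤ P.real good
  linarith

lemma IsHaarDistributed.aemeasurable_haarSketch_apply {Ω : Type*} [MeasurableSpace Ω]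
    {P : Measure Ω} {n p : ℕ} (hpn : p ≤ n) {U : Ω → Matrix.orthogonalGroup (Fin n) ℝ}
    (hU : IsHaarDistributed U P) (i : Fin n) (j : Fin p) :
    AEMeasurable (fun ω => haarSketch hpn (U ω) i j) P := by
  have hcont : Continuous fun V : Matrix.orthogonalGroup (Fin n) ℝ => haarSketch hpn V i j := by
    change Continuous fun V : Matrix.orthogonalGroup (Fin n) ℝ =>
      √(n / p) * (V : Matrix (Fin n) (Fin n) ℝ) (Fin.castLE hpn j) i
    exact continuous_const.mul (continuous_subtype_val.matrix_elem _ _)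
  exact hcont.measurable.comp_aemeasurable hU.1

lemma IsJLTransform.isWellAligned {Ω : Type*} [MeasurableSpace Ω] {P : Measure Ω}
    [IsFiniteMeasure P] {n p : ℕ} {Q : Ω → Matrix (Fin n) (Fin p) ℝ} {α β ε : ℝ}
    (hQ : IsJLTransform ε β Q P) (hmeas : ∀ i j, AEMeasurable (fun ω => Q ω i j) P)
    (hα : α ∈ Set.Ioo (0 : ℝ) (1 / 2)) (hβ : β ∈ Set.Ioo (0 : ℝ) (1 / 2)) (hαε : α ≤ 1 - ε) :
    IsWellAligned α β Q P := by
  refine ⟨hα, hβ, hmeas, fun v => (hQ v).trans (measureReal_mono ?_)⟩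
  rintro ω ⟨h, -⟩
  exact (mul_le_mul_of_nonneg_right hαε (norm_nonneg v)).trans h

theorem mainTheorem5 :
    ∃ η : ℝ, 0 < η ∧
      ∀ ε β : ℝ, ε ∈ Set.Ioo (0 : ℝ) 1 → β ∈ Set.Ioo (0 : ℝ) 1 →
        (∀ (n p : ℕ) (hpn : p ≤ n),
          4 / η * ε⁻¹ ^ 2 * Real.log (2 / β) ≤ (p : ℝ) →
          ∀ (Ω : Type u) [MeasurableSpace Ω] (P : Measure Ω) [IsProbabilityMeasure P]
            (U : Ω → Matrix.orthogonalGroup (Fin n) ℝ), IsHaarDistributed U P →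
            IsJLTransform ε β (fun ω => haarSketch hpn (U ω)) P ∧
            ∀ α : ℝ, α ∈ Set.Ioo (0 : ℝ) (1 / 2) → α ≤ 1 - ε → β < 1 / 2 →
              IsWellAligned α β (fun ω => haarSketch hpn (U ω)) P) ∧
        (∃ p₀ : ℕ, 0 < p₀ ∧
          ∀ (n p : ℕ) (hpn : p ≤ n), p₀ ≤ p →
          ∀ (Ω : Type u) [MeasurableSpace Ω] (P : Measure Ω) [IsProbabilityMeasure P]
            (U : Ω → Matrix.orthogonalGroup (Fin n) ℝ), IsHaarDistributed U P →
            IsJLTransform ε β (fun ω => haarSketch hpn (U ω)) P ∧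
            ∀ α : ℝ, α ∈ Set.Ioo (0 : ℝ) (1 / 2) → α ≤ 1 - ε → β < 1 / 2 →
              IsWellAligned α β (fun ω => haarSketch hpn (U ω)) P) := by
  -- With `η = 2` the bound on `p` is exactly `exp (-p ε² / 2) ≤ β / 2`, half the failure budget per
  -- tail.
  refine ⟨2, two_pos, fun ε β hε hβ => ?_⟩
  have main : ∀ (n p : ℕ) (hpn : p ≤ n), 4 / 2 * ε⁻¹ ^ 2 * Real.log (2 / β) ≤ (p : ℝ) →
      ∀ (Ω : Type u) [MeasurableSpace Ω] (P : Measure Ω) [IsProbabilityMeasure P]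
        (U : Ω → Matrix.orthogonalGroup (Fin n) ℝ), IsHaarDistributed U P →
        IsJLTransform ε β (fun ω => haarSketch hpn (U ω)) P ∧
        ∀ α : ℝ, α ∈ Set.Ioo (0 : ℝ) (1 / 2) → α ≤ 1 - ε → β < 1 / 2 →
          IsWellAligned α β (fun ω => haarSketch hpn (U ω)) P := by
    intro n p hpn hp Ω _ P _ U hU
    have hJL := isJLTransform_haarSketch hpn hU hε hβ (by linarith)
    exact ⟨hJL, fun α hα hαε hβ' =>
      hJL.isWellAligned (hU.aemeasurable_haarSketch_apply hpn) hα ⟨hβ.1, hβ'⟩ hαε⟩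
  refine ⟨main, ⌈4 / 2 * ε⁻¹ ^ 2 * Real.log (2 / β)⌉₊ + 1, Nat.succ_pos _, ?_⟩
  intro n p hpn hp
  refine main n p hpn ((Nat.le_ceil _).trans ?_)
  exact_mod_cast (Nat.le_succ _).trans hp
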